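/- Let $\Pi=[\pi_{ij}]_{i,j\in\{0,1\}}$ be a stochastic matrix with all $\pi_{ij}>0$ and $\det\Pi>0$, and let $0<\varepsilon<1$. Let $(Y_n)_{n\in\mathbb Z}$ be a stationary Markov chain on $\{0,1\}$ with transition matrix $\Pi$, let $(E_n)_{n\in\mathbb Z}$ be i.i.d. with $P(E_n=1)=\varepsilon$, $P(E_n=0)=1-\varepsilon$, independent of $Y$, and let $Z_n=Y_n+E_n \pmod 2$. Put $p_E(0)=1-\varepsilon$, $p_E(1)=\varepsilon$, $\bar z=1-z$ and $$f_z(x)=\frac{p_E(z)}{p_E(\bar z)}\cdot\frac{\pi_{00}x+\pi_{10}}{\pi_{01}x+\pi_{11}},\qquad z=0,1.$$ Each $f_z$ has a unique positive fixed point $p_z$. Let $I$ be the closed interval with endpoints $p_1$ and $p_0$ (that is, $I=[p_1,p_0]$ when $\varepsilon\le 1/2$), and for a word $i_1\cdots i_n\in\{0,1\}^n$, $n\ge 0$, let $$I_{i_1\cdots i_n}=f_{i_n}\circ\cdots\circ f_{i_1}(I),\qquad p_{i_1\cdots i_n}=P(Z_1=i_1,\dots,Z_n=i_n).$$ Let $x_0=\pi_{10}/\pi_{01}$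 and $x_n=f_{Z_n}(x_{n-1})$ for $n\ge1$, and let $$Q_n=\sum_{w\in\{0,1\}^n}p_w\,\delta_{x_n(w)},\qquad x_n(i_1\cdots i_n)=f_{i_n}\circ\cdots\circ f_{i_1}(x_0).$$ Assume the non-overlapping case: $f_0(I)\cup f_1(I)\subsetneq I$. Then the random variables $x_n$ converge in distribution to a probability measure $Q$ on $\mathbb R$ (the limiting distribution of $x_n$), and for every $n\geq 0$ and every word $i_1\cdots i_n$ $$Q(I_{i_1\cdots i_n})=Q_n(I_{i_1\cdots i_n})=p_{i_1\cdots i_n}.$$ -/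

import Mathlib

open MeasureTheory ProbabilityTheory Filter Topology

namespace BinaryHMM

/-! ### The stationary binary Markov chain seen through a binary symmetric channel -/

/-- `Y` is a stationary Markov chain (indexed by `ℤ`) with transition matrix `P`. The Markov
property is written in product form, so that conditioning on null events needs no convention. -/
structure IsStationaryMarkovChain {S Ω : Type*} [MeasurableSpace S] [MeasurableSpace Ω]
    (P : Matrix S S ℝ) (μ : Measure Ω) (Y : ℤ → Ω → S) : Prop where
  measurable : ∀ n, Measurable (Y n)
  markov : ∀ (m : ℤ) (k : ℕ) (s : ℕ → S),
    μ.real {ω | ∀ j ≤ k + 1, Y (m + (j : ℤ)) ω = s j} =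
      μ.real {ω | ∀ j ≤ k, Y (m + (j : ℤ)) ω = s j} * P (s k) (s (k + 1))
  stationary : ∀ (m : ℤ) (s : S), μ.real {ω | Y (m + 1) ω = s} = μ.real {ω | Y m ω = s}

/-- `E` is an i.i.d. binary noise process, with `E n = 1` (a transmission error) having
probability `ε`. -/
structure IsBernoulliNoise {Ω : Type*} [MeasurableSpace Ω]
    (ε : ℝ) (μ : Measure Ω) (E : ℤ → Ω → Fin 2) : Prop where
  measurable : ∀ n, Measurable (E n)
  indep : iIndepFun E μ
  prob_error : ∀ n, μ.real {ω | E n ω = 1} = ε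

/-- The observed process `Z n = Y n + E n` (addition modulo `2`). -/
def observed {Ω : Type*} (Y E : ℤ → Ω → Fin 2) (n : ℤ) (ω : Ω) : Fin 2 := Y n ω + E n ω

/-- The observed word `z₁ z₂ ⋯ zₙ`; its letters are indexed by `Fin n`, starting at `0`. -/
def observedWord {Ω : Type*} (Y E : ℤ → Ω → Fin 2) (n : ℕ) (ω : Ω) : Fin n → Fin 2 :=
  fun j => observed Y E ((j : ℤ) + 1) ω

/-! ### The dynamical system on the positive half-line -/

/-- The noise distribution `p_E`: `p_E(0) = 1 - ε`, `p_E(1) = ε`. -/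
def noiseProb (ε : ℝ) : Fin 2 → ℝ := ![1 - ε, ε]

/-- `f_z(x) = (p_E(z) / p_E(z̄)) (π₀₀ x + π₁₀) / (π₀₁ x + π₁₁)`. -/
noncomputable def f (P : Matrix (Fin 2) (Fin 2) ℝ) (ε : ℝ) (z : Fin 2) (x : ℝ) : ℝ :=
  noiseProb ε z / noiseProb ε (1 - z) * ((P 0 0 * x + P 1 0) / (P 0 1 * x + P 1 1))

/-- For a word `w = i₁ ⋯ iₙ`, the composition `f_{iₙ} ∘ ⋯ ∘ f_{i₁}`. -/
noncomputable def fWord (P : Matrix (Fin 2) (Fin 2) ℝ) (ε : ℝ) :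
    (n : ℕ) → (Fin n → Fin 2) → ℝ → ℝ
  | 0, _ => id
  | n + 1, w => f P ε (w (Fin.last n)) ∘ fWord P ε n (fun j => w j.castSucc)

/-- The random point `xₙ = f_{zₙ}(xₙ₋₁)`, started at `x₀ = π₁₀ / π₀₁`. -/
noncomputable def xPoint {Ω : Type*} (P : Matrix (Fin 2) (Fin 2) ℝ) (ε : ℝ)
    (Y E : ℤ → Ω → Fin 2) (n : ℕ) (ω : Ω) : ℝ :=
  fWord P ε n (observedWord Y E n ω) (P 1 0 / P 0 1)

/-- The positive fixed point `p_z` of `f_z`; see `existsUnique_fixedPoint`. -/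
noncomputable def fixedPoint (P : Matrix (Fin 2) (Fin 2) ℝ) (ε : ℝ) (z : Fin 2) : ℝ :=
  Classical.epsilon fun x : ℝ => 0 < x ∧ f P ε z x = x

theorem existsUnique_fixedPoint (P : Matrix (Fin 2) (Fin 2) ℝ) (ε : ℝ) (hP : ∀ i j, 0 < P i j)
    (hε0 : 0 < ε) (hε1 : ε < 1) (z : Fin 2) : ∃! x : ℝ, 0 < x ∧ f P ε z x = x := by
  obtain ⟨c, hc, hf⟩ : ∃ c : ℝ, 0 < c ∧
      ∀ x, f P ε z x = c * ((P 0 0 * x + P 1 0) / (P 0 1 * x + P 1 1)) := by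
    refine ⟨noiseProb ε z / noiseProb ε (1 - z), ?_, fun x => rfl⟩
    have h1 : 0 < 1 - ε := by linarith
    fin_cases z <;> simp [noiseProb] <;> positivity
  have h00 := hP 0 0
  have h01 := hP 0 1
  have h10 := hP 1 0
  have h11 := hP 1 1
  -- being a positive fixed point amounts to a quadratic equation with roots of opposite signs
  have key : ∀ x : ℝ, 0 < x →
      (f P ε z x = x ↔ P 0 1 * x * x + (P 1 1 - c * P 0 0) * x = c * P 1 0) := by
    intro x hx
    have hd : 0 < P 0 1 * x + P 1 1 := by positivity
    rw [hf, ← mul_div_assoc, div_eq_iff hd.ne']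
    constructor <;> intro h <;> linarith
  obtain ⟨b, hb⟩ : ∃ b, b = P 1 1 - c * P 0 0 := ⟨_, rfl⟩
  have hq : 0 < 4 * P 0 1 * (c * P 1 0) := by positivity
  have hD : 0 ≤ b ^ 2 + 4 * P 0 1 * (c * P 1 0) := by positivity
  obtain ⟨s, hs⟩ : ∃ s, s = √(b ^ 2 + 4 * P 0 1 * (c * P 1 0)) := ⟨_, rfl⟩
  have hs2 : s ^ 2 = b ^ 2 + 4 * P 0 1 * (c * P 1 0) := by rw [hs]; exact Real.sq_sqrt hD
  have hs0 : 0 ≤ s := hs ▸ Real.sqrt_nonneg _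
  have hsb : b < s := by
    by_contra hcon
    nlinarith
  have hx : 0 < (s - b) / (2 * P 0 1) := div_pos (by linarith) (by positivity)
  refine ⟨(s - b) / (2 * P 0 1), ⟨hx, (key _ hx).2 ?_⟩, ?_⟩
  · rw [← hb]
    field_simp
    nlinarith
  · rintro y ⟨hy, hfy⟩
    have e1 := (key y hy).1 hfy
    have e2 : P 0 1 * ((s - b) / (2 * P 0 1)) * ((s - b) / (2 * P 0 1)) +
        b * ((s - b) / (2 * P 0 1)) = c * P 1 0 := by
      field_simp
      nlinarith
    rw [← hb] at e1
    generalize (s - b) / (2 * P 0 1) = x at hx e2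
    have hsx : P 0 1 * x + b = c * P 1 0 / x := by
      rw [eq_div_iff hx.ne']; linarith
    have hpos : 0 < P 0 1 * x + b := by rw [hsx]; positivity
    have hm : (y - x) * (P 0 1 * y + (P 0 1 * x + b)) = 0 := by linarith
    rcases mul_eq_zero.1 hm with h | h
    · linarith
    · have : 0 < P 0 1 * y := by positivity
      linarith

theorem fixedPoint_spec (P : Matrix (Fin 2) (Fin 2) ℝ) (ε : ℝ) (hP : ∀ i j, 0 < P i j)
    (hε0 : 0 < ε) (hε1 : ε < 1) (z : Fin 2) :
    0 < fixedPoint P ε z ∧ f P ε z (fixedPoint P ε z) = fixedPoint P ε z :=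
  Classical.epsilon_spec (existsUnique_fixedPoint P ε hP hε0 hε1 z).exists

/-- The closed interval `I` with endpoints `p₁` and `p₀`; it is `[p₁, p₀]` for `ε ≤ 1/2`, where
`p₁ ≤ p₀`. -/
noncomputable def interval (P : Matrix (Fin 2) (Fin 2) ℝ) (ε : ℝ) : Set ℝ :=
  Set.uIcc (fixedPoint P ε 1) (fixedPoint P ε 0)

/-- The cylinder interval `I_{i₁ ⋯ iₙ} = f_{iₙ} ∘ ⋯ ∘ f_{i₁} (I)` of a word. -/
noncomputable def cylinder (P : Matrix (Fin 2) (Fin 2) ℝ) (ε : ℝ) (n : ℕ) (w : Fin n → Fin 2) :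
    Set ℝ :=
  fWord P ε n w '' interval P ε

/-- The non-overlapping case: `f₀(I) ∪ f₁(I)` is a proper subset of `I`. -/
def NonOverlapping (P : Matrix (Fin 2) (Fin 2) ℝ) (ε : ℝ) : Prop :=
  f P ε 0 '' interval P ε ∪ f P ε 1 '' interval P ε ⊂ interval P ε

/-! ### The measures -/

/-- The probability `p(z₁ = i₁, …, zₙ = iₙ)` of a word. -/
noncomputable def wordProb {Ω : Type*} [MeasurableSpace Ω] (μ : Measure Ω)
    (Y E : ℤ → Ω → Fin 2) (n : ℕ) (w : Fin n → Fin 2) : ENNReal :=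
  μ {ω | observedWord Y E n ω = w}

/-- The measure `Qₙ`: each word `w` of length `n` contributes its probability as a point mass
at the point `xₙ(w)` that it determines. -/
noncomputable def Qn {Ω : Type*} [MeasurableSpace Ω] (P : Matrix (Fin 2) (Fin 2) ℝ) (ε : ℝ)
    (μ : Measure Ω) (Y E : ℤ → Ω → Fin 2) (n : ℕ) : Measure ℝ :=
  ∑ w : Fin n → Fin 2, wordProb μ Y E n w • Measure.dirac (fWord P ε n w (P 1 0 / P 0 1))

end BinaryHMM

namespace BinaryHMM

/-! ### Contraction in logarithmic coordinates -/

section Dynamics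

variable {P : Matrix (Fin 2) (Fin 2) ℝ} {ε : ℝ}

/-! The forward orbit `xPoint` need not converge pointwise, but `Z` is stationary, so `xₙ` has the
law of `backwardPoint`: `x₀` driven by `Z₋ₙ₊₁, …, Z₀`. There a larger `n` only adds innermost maps.
Each `f_z` contracts `|log x - log y|` by a factor `< 1`, so the backward points converge for every
`ω` (`NonOverlapping.exists_tendsto_backwardPoint`), and `Q` is the law of the limit.

Cylinders are closed, so the limit lies in the cylinder of the last `n` letters. Equal-length
cylinders of distinct words are disjoint (`NonOverlapping.word_eq`), so the limit lies in `I_w`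
exactly when these letters spell `w`, which has probability `p_w` by stationarity. The same
disjointness, with `x₀ ∈ I`, gives the value of `Qₙ`. -/

theorem noiseProb_pos (hε_pos : 0 < ε) (hε_lt : ε < 1) (z : Fin 2) : 0 < noiseProb ε z := by
  fin_cases z <;> simp [noiseProb, hε_pos, hε_lt]

theorem f_eq_mul (P : Matrix (Fin 2) (Fin 2) ℝ) (hε_pos : 0 < ε) (hε_lt : ε < 1) (z : Fin 2) :
    ∃ c : ℝ, 0 < c ∧ ∀ x, f P ε z x = c * ((P 0 0 * x + P 1 0) / (P 0 1 * x + P 1 1)) :=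
  ⟨_, div_pos (noiseProb_pos hε_pos hε_lt z) (noiseProb_pos hε_pos hε_lt (1 - z)), fun _ => rfl⟩

theorem f_pos (hP : ∀ i j, 0 < P i j) (hε_pos : 0 < ε) (hε_lt : ε < 1) (z : Fin 2) {x : ℝ}
    (hx : 0 < x) : 0 < f P ε z x := by
  obtain ⟨c, hc, hf⟩ := f_eq_mul P hε_pos hε_lt z
  have h00 := hP 0 0
  have h01 := hP 0 1
  have h10 := hP 1 0
  have h11 := hP 1 1
  rw [hf]
  positivity

theorem f_strictMonoOn (hP : ∀ i j, 0 < P i j) (hP_det : 0 < P.det) (hε_pos : 0 < ε)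
    (hε_lt : ε < 1) (z : Fin 2) : StrictMonoOn (f P ε z) (Set.Ioi 0) := by
  intro x hx y hy hxy
  rw [Set.mem_Ioi] at hx hy
  obtain ⟨c, hc, hf⟩ := f_eq_mul P hε_pos hε_lt z
  have h01 := hP 0 1
  have h11 := hP 1 1
  rw [Matrix.det_fin_two] at hP_det
  rw [hf, hf]
  refine mul_lt_mul_of_pos_left ?_ hc
  rw [div_lt_div_iff₀ (by positivity) (by positivity)]
  linarith [mul_pos hP_det (sub_pos.2 hxy)]

theorem f_continuousOn (hP : ∀ i j, 0 < P i j) (z : Fin 2) :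
    ContinuousOn (f P ε z) (Set.Ioi 0) := by
  have h01 := hP 0 1
  have h11 := hP 1 1
  unfold f
  refine ContinuousOn.mul continuousOn_const (ContinuousOn.div (by fun_prop) (by fun_prop) ?_)
  intro x hx
  rw [Set.mem_Ioi] at hx
  positivity

/-- The contraction constant of the maps `f_z` in the metric `|log x - log y|`. -/
noncomputable def contraction (P : Matrix (Fin 2) (Fin 2) ℝ) : ℝ :=
  P.det / (P 0 0 * P 1 1 + P 0 1 * P 1 0)

theorem contraction_nonneg (hP : ∀ i j, 0 < P i j) (hP_det : 0 < P.det) : 0 ≤ contraction P :=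
  div_nonneg hP_det.le (add_pos (mul_pos (hP _ _) (hP _ _)) (mul_pos (hP _ _) (hP _ _))).le

theorem contraction_lt_one (hP : ∀ i j, 0 < P i j) : contraction P < 1 := by
  have h1 := mul_pos (hP 0 0) (hP 1 1)
  have h2 := mul_pos (hP 0 1) (hP 1 0)
  rw [contraction, div_lt_one (by positivity), Matrix.det_fin_two]
  linarith

/-- In the coordinate `t = log x` the noise factor is only an additive constant, so the mean value
inequality gives one bound for both letters. -/
theorem abs_log_f_sub_le (hP : ∀ i j, 0 < P i j) (hP_det : 0 < P.det) (hε_pos : 0 < ε)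
    (hε_lt : ε < 1) (z : Fin 2) {x y : ℝ} (hx : 0 < x) (hy : 0 < y) :
    |Real.log (f P ε z x) - Real.log (f P ε z y)| ≤
      contraction P * |Real.log x - Real.log y| := by
  obtain ⟨c, hc, hf⟩ := f_eq_mul P hε_pos hε_lt z
  have h00 := hP 0 0
  have h01 := hP 0 1
  have h10 := hP 1 0
  have h11 := hP 1 1
  have hlog : ∀ t, 0 < t → Real.log (f P ε z t) =
      Real.log c + (Real.log (P 0 0 * t + P 1 0) - Real.log (P 0 1 * t + P 1 1)) := by
    intro t ht
    rw [hf, Real.log_mul hc.ne' (by positivity), Real.log_div (by positivity) (by positivity)]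
  have hderiv : ∀ t ∈ (Set.univ : Set ℝ), HasDerivWithinAt (fun t => Real.log c +
      (Real.log (P 0 0 * Real.exp t + P 1 0) - Real.log (P 0 1 * Real.exp t + P 1 1)))
      (P 0 0 * Real.exp t / (P 0 0 * Real.exp t + P 1 0) -
        P 0 1 * Real.exp t / (P 0 1 * Real.exp t + P 1 1)) Set.univ t := by
    intro t _
    have he := Real.exp_pos t
    have h1 := (((Real.hasDerivAt_exp t).const_mul (P 0 0)).add_const (P 1 0)).log
      (by positivity)
    have h2 := (((Real.hasDerivAt_exp t).const_mul (P 0 1)).add_const (P 1 1)).log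
      (by positivity)
    exact ((h1.sub h2).const_add _).hasDerivWithinAt
  have hbound : ∀ t ∈ (Set.univ : Set ℝ),
      ‖P 0 0 * Real.exp t / (P 0 0 * Real.exp t + P 1 0) -
        P 0 1 * Real.exp t / (P 0 1 * Real.exp t + P 1 1)‖ ≤ contraction P := by
    intro t _
    have he := Real.exp_pos t
    generalize Real.exp t = u at he
    have heq : P 0 0 * u / (P 0 0 * u + P 1 0) - P 0 1 * u / (P 0 1 * u + P 1 1) =
        u * P.det / ((P 0 0 * u + P 1 0) * (P 0 1 * u + P 1 1)) := by
      rw [Matrix.det_fin_two, div_sub_div _ _ (by positivity) (by positivity)]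
      congr 1
      ring
    rw [heq, Real.norm_of_nonneg (by positivity), contraction,
      div_le_div_iff₀ (by positivity) (by positivity)]
    -- The terms of the expanded denominator other than the one linear in `u`.
    have : 0 ≤ P.det * (P 0 0 * P 0 1 * u ^ 2 + P 1 0 * P 1 1) := by positivity
    linarith
  have hmvt := Convex.norm_image_sub_le_of_norm_hasDerivWithin_le hderiv hbound convex_univ
    (Set.mem_univ (Real.log y)) (Set.mem_univ (Real.log x))
  rw [hlog x hx, hlog y hy]
  simpa only [Real.norm_eq_abs, Real.exp_log hx, Real.exp_log hy] using hmvt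

/-- Away from its fixed point, `f_z` moves points towards it. -/
theorem le_fixedPoint (hP : ∀ i j, 0 < P i j) (hP_det : 0 < P.det) (hε_pos : 0 < ε)
    (hε_lt : ε < 1) (z : Fin 2) {x : ℝ} (hx : 0 < x) (h : x ≤ f P ε z x) :
    x ≤ fixedPoint P ε z := by
  obtain ⟨hp, hfp⟩ := fixedPoint_spec P ε hP hε_pos hε_lt z
  by_contra! hlt
  have h1 := abs_log_f_sub_le hP hP_det hε_pos hε_lt z hx hp
  rw [hfp] at h1
  have h2 := Real.log_lt_log hp hlt
  have h3 := Real.log_le_log hx h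
  rw [abs_of_pos (by linarith), abs_of_pos (by linarith)] at h1
  nlinarith [contraction_lt_one hP]

theorem fixedPoint_le (hP : ∀ i j, 0 < P i j) (hP_det : 0 < P.det) (hε_pos : 0 < ε)
    (hε_lt : ε < 1) (z : Fin 2) {x : ℝ} (hx : 0 < x) (h : f P ε z x ≤ x) :
    fixedPoint P ε z ≤ x := by
  obtain ⟨hp, hfp⟩ := fixedPoint_spec P ε hP hε_pos hε_lt z
  by_contra! hlt
  have h1 := abs_log_f_sub_le hP hP_det hε_pos hε_lt z hx hp
  rw [hfp] at h1
  have h2 := Real.log_lt_log hx hlt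
  have h3 := Real.log_le_log (f_pos hP hε_pos hε_lt z hx) h
  rw [abs_of_neg (by linarith), abs_of_neg (by linarith)] at h1
  nlinarith [contraction_lt_one hP]

/-! ### The interval and its cylinders -/

theorem pos_of_mem_interval (hP : ∀ i j, 0 < P i j) (hε_pos : 0 < ε) (hε_lt : ε < 1) {x : ℝ}
    (hx : x ∈ interval P ε) : 0 < x :=
  (lt_min (fixedPoint_spec P ε hP hε_pos hε_lt 1).1
    (fixedPoint_spec P ε hP hε_pos hε_lt 0).1).trans_le hx.1

theorem start_pos (hP : ∀ i j, 0 < P i j) : 0 < P 1 0 / P 0 1 := div_pos (hP _ _) (hP _ _)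

/-- `x₀` is the ratio of the stationary probabilities of `Π`, hence fixed by the noiseless map; only
the noise factor moves it. -/
theorem f_start (hP : ∀ i j, 0 < P i j) (hP_sum : ∀ i, ∑ j, P i j = 1) (z : Fin 2) :
    f P ε z (P 1 0 / P 0 1) = noiseProb ε z / noiseProb ε (1 - z) * (P 1 0 / P 0 1) := by
  have h01 := hP 0 1
  have h0 := hP_sum 0
  have h1 := hP_sum 1
  rw [Fin.sum_univ_two] at h0 h1
  have hden : P 0 1 * (P 1 0 / P 0 1) + P 1 1 = 1 := by
    rw [mul_div_cancel₀ _ h01.ne', h1]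
  have hnum : P 0 0 * (P 1 0 / P 0 1) + P 1 0 = P 1 0 / P 0 1 := by
    rw [eq_sub_of_add_eq h0]
    field_simp
    ring
  rw [f, hden, hnum, div_one]

theorem fixedPoint_ordered (hP : ∀ i j, 0 < P i j) (hP_sum : ∀ i, ∑ j, P i j = 1)
    (hP_det : 0 < P.det) (hε_pos : 0 < ε) (hε_lt : ε < 1) {z : Fin 2}
    (hz : noiseProb ε (1 - z) ≤ noiseProb ε z) :
    fixedPoint P ε (1 - z) ≤ P 1 0 / P 0 1 ∧ P 1 0 / P 0 1 ≤ fixedPoint P ε z := by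
  have hx := start_pos hP
  constructor
  · refine fixedPoint_le hP hP_det hε_pos hε_lt _ hx ?_
    rw [f_start hP hP_sum, sub_sub_cancel]
    exact mul_le_of_le_one_left hx.le ((div_le_one (noiseProb_pos hε_pos hε_lt _)).2 hz)
  · refine le_fixedPoint hP hP_det hε_pos hε_lt _ hx ?_
    rw [f_start hP hP_sum]
    exact le_mul_of_one_le_left hx.le ((one_le_div (noiseProb_pos hε_pos hε_lt _)).2 hz)

theorem exists_noiseProb_le (ε : ℝ) : ∃ z : Fin 2, noiseProb ε (1 - z) ≤ noiseProb ε z :=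
  (le_total (noiseProb ε 1) (noiseProb ε 0)).elim (fun h => ⟨0, h⟩) (fun h => ⟨1, h⟩)

theorem interval_eq (P : Matrix (Fin 2) (Fin 2) ℝ) (ε : ℝ) (z : Fin 2) :
    interval P ε = Set.uIcc (fixedPoint P ε (1 - z)) (fixedPoint P ε z) := by
  fin_cases z
  · rfl
  · exact Set.uIcc_comm _ _

theorem start_mem_interval (hP : ∀ i j, 0 < P i j) (hP_sum : ∀ i, ∑ j, P i j = 1)
    (hP_det : 0 < P.det) (hε_pos : 0 < ε) (hε_lt : ε < 1) :
    P 1 0 / P 0 1 ∈ interval P ε := by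
  obtain ⟨z, hz⟩ := exists_noiseProb_le ε
  rw [interval_eq P ε z]
  exact Set.mem_uIcc_of_le (fixedPoint_ordered hP hP_sum hP_det hε_pos hε_lt hz).1
    (fixedPoint_ordered hP hP_sum hP_det hε_pos hε_lt hz).2

theorem NonOverlapping.f_mem_interval (hno : NonOverlapping P ε) (z : Fin 2) {x : ℝ}
    (hx : x ∈ interval P ε) : f P ε z x ∈ interval P ε := by
  apply hno.subset
  fin_cases z
  · exact Or.inl ⟨x, hx, rfl⟩
  · exact Or.inr ⟨x, hx, rfl⟩

/-- The image of `g` is an interval starting at `a`, that of `h` one ending at `b`; `h y ≤ g x`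
leaves no gap between them. -/
theorem _root_.Set.Icc_subset_image_union_image {g h : ℝ → ℝ} {a b x y : ℝ} (hab : a ≤ b)
    (hg : ContinuousOn g (Set.Icc a b)) (hh : ContinuousOn h (Set.Icc a b))
    (hgm : MonotoneOn g (Set.Icc a b)) (hhm : MonotoneOn h (Set.Icc a b))
    (ha : g a = a) (hb : h b = b) (hx : x ∈ Set.Icc a b) (hy : y ∈ Set.Icc a b)
    (hxy : h y ≤ g x) : Set.Icc a b ⊆ g '' Set.Icc a b ∪ h '' Set.Icc a b := by
  have h1 : h a ≤ g b := calc
    h a ≤ h y := hhm (Set.left_mem_Icc.2 hab) hy hy.1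
    _ ≤ g x := hxy
    _ ≤ g b := hgm hx (Set.right_mem_Icc.2 hab) hx.2
  intro t ht
  rcases le_total t (g b) with h2 | h2
  · exact Or.inl (intermediate_value_Icc hab hg ⟨ha.trans_le ht.1, h2⟩)
  · exact Or.inr (intermediate_value_Icc hab hh ⟨h1.trans h2, ht.2.trans_eq hb.symm⟩)

/-- Each of the two maps fixes one endpoint of `I`, so images that met would cover `I`, against the
proper inclusion. -/
theorem NonOverlapping.f_ne (hno : NonOverlapping P ε) (hP : ∀ i j, 0 < P i j)
    (hP_sum : ∀ i, ∑ j, P i j = 1) (hP_det : 0 < P.det) (hε_pos : 0 < ε) (hε_lt : ε < 1)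
    {x y : ℝ} (hx : x ∈ interval P ε) (hy : y ∈ interval P ε) (z : Fin 2) :
    f P ε (1 - z) x ≠ f P ε z y := by
  have aux : ∀ z : Fin 2, noiseProb ε (1 - z) ≤ noiseProb ε z → ∀ x ∈ interval P ε,
      ∀ y ∈ interval P ε, f P ε (1 - z) x ≠ f P ε z y := by
    intro z hz x hx y hy hxy
    obtain ⟨h1, h2⟩ := fixedPoint_ordered hP hP_sum hP_det hε_pos hε_lt hz
    have hI : interval P ε = Set.Icc (fixedPoint P ε (1 - z)) (fixedPoint P ε z) := by
      rw [interval_eq P ε z, Set.uIcc_of_le (h1.trans h2)]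
    have hpos : interval P ε ⊆ Set.Ioi 0 := fun t => pos_of_mem_interval hP hε_pos hε_lt
    have hcont := fun z => (f_continuousOn (ε := ε) hP z).mono hpos
    have hmono := fun z => ((f_strictMonoOn hP hP_det hε_pos hε_lt z).mono hpos).monotoneOn
    have hsub : interval P ε ⊆ f P ε (1 - z) '' interval P ε ∪ f P ε z '' interval P ε := by
      rw [hI] at hx hy hcont hmono ⊢
      exact Set.Icc_subset_image_union_image (h1.trans h2) (hcont _) (hcont _) (hmono _)
        (hmono _) (fixedPoint_spec P ε hP hε_pos hε_lt _).2
        (fixedPoint_spec P ε hP hε_pos hε_lt _).2 hx hy hxy.ge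
    refine hno.2 (hsub.trans ?_)
    fin_cases z
    · exact (Set.union_comm _ _).subset
    · exact subset_rfl
  -- The likelier noise letter owns the right endpoint; swapping the letters covers both sides of `ε
  -- = 1/2`.
  rcases le_total (noiseProb ε (1 - z)) (noiseProb ε z) with h | h
  · exact aux z h x hx y hy
  · have := aux (1 - z) (by rwa [sub_sub_cancel]) y hy x hx
    rw [sub_sub_cancel] at this
    exact this.symm

theorem NonOverlapping.letter_eq (hno : NonOverlapping P ε) (hP : ∀ i j, 0 < P i j)
    (hP_sum : ∀ i, ∑ j, P i j = 1) (hP_det : 0 < P.det) (hε_pos : 0 < ε) (hε_lt : ε < 1)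
    {x y : ℝ} (hx : x ∈ interval P ε) (hy : y ∈ interval P ε) {u v : Fin 2}
    (h : f P ε u x = f P ε v y) : u = v := by
  by_contra huv
  have hother : ∀ u v : Fin 2, u ≠ v → u = 1 - v := by decide
  exact hno.f_ne hP hP_sum hP_det hε_pos hε_lt hx hy v (hother u v huv ▸ h)

theorem NonOverlapping.fWord_mem_interval (hno : NonOverlapping P ε) {n : ℕ}
    (w : Fin n → Fin 2) {x : ℝ} (hx : x ∈ interval P ε) :
    fWord P ε n w x ∈ interval P ε := by
  induction n with
  | zero => exact hx
  | succ n ih => exact hno.f_mem_interval _ (ih _)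

/-- Distinct words of the same length have disjoint cylinders. -/
theorem NonOverlapping.word_eq (hno : NonOverlapping P ε) (hP : ∀ i j, 0 < P i j)
    (hP_sum : ∀ i, ∑ j, P i j = 1) (hP_det : 0 < P.det) (hε_pos : 0 < ε) (hε_lt : ε < 1)
    {n : ℕ} {v w : Fin n → Fin 2} {x y : ℝ} (hx : x ∈ interval P ε) (hy : y ∈ interval P ε)
    (h : fWord P ε n v x = fWord P ε n w y) : v = w := by
  induction n with
  | zero => exact Subsingleton.elim _ _
  | succ n ih =>
    have hx' := hno.fWord_mem_interval (fun j => v j.castSucc) hx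
    have hy' := hno.fWord_mem_interval (fun j => w j.castSucc) hy
    change f P ε _ _ = f P ε _ _ at h
    have hlast := hno.letter_eq hP hP_sum hP_det hε_pos hε_lt hx' hy' h
    rw [hlast] at h
    have hinit := ih ((f_strictMonoOn hP hP_det hε_pos hε_lt _).injOn
      (pos_of_mem_interval hP hε_pos hε_lt hx') (pos_of_mem_interval hP hε_pos hε_lt hy') h)
    funext j
    refine Fin.lastCases hlast (fun i => congrFun hinit i) j

theorem NonOverlapping.fWord_mem_cylinder (hno : NonOverlapping P ε) (hP : ∀ i j, 0 < P i j)
    (hP_sum : ∀ i, ∑ j, P i j = 1) (hP_det : 0 < P.det) (hε_pos : 0 < ε) (hε_lt : ε < 1)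
    {n : ℕ} {v w : Fin n → Fin 2} {x : ℝ} (hx : x ∈ interval P ε) :
    fWord P ε n v x ∈ cylinder P ε n w ↔ v = w := by
  constructor
  · rintro ⟨y, hy, h⟩
    exact (hno.word_eq hP hP_sum hP_det hε_pos hε_lt hy hx h).symm
  · rintro rfl
    exact ⟨x, hx, rfl⟩

theorem NonOverlapping.fWord_continuousOn (hno : NonOverlapping P ε) (hP : ∀ i j, 0 < P i j)
    (hε_pos : 0 < ε) (hε_lt : ε < 1) {n : ℕ} (w : Fin n → Fin 2) :
    ContinuousOn (fWord P ε n w) (interval P ε) := by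
  induction n with
  | zero => exact continuousOn_id
  | succ n ih =>
    exact (f_continuousOn hP _).comp (ih _) fun x hx =>
      pos_of_mem_interval hP hε_pos hε_lt (hno.fWord_mem_interval _ hx)

theorem NonOverlapping.isClosed_cylinder (hno : NonOverlapping P ε) (hP : ∀ i j, 0 < P i j)
    (hε_pos : 0 < ε) (hε_lt : ε < 1) {n : ℕ} (w : Fin n → Fin 2) :
    IsClosed (cylinder P ε n w) :=
  (isCompact_uIcc.image_of_continuousOn
    (hno.fWord_continuousOn hP hε_pos hε_lt w)).isClosed

theorem fWord_pos (hP : ∀ i j, 0 < P i j) (hε_pos : 0 < ε) (hε_lt : ε < 1) {n : ℕ}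
    (w : Fin n → Fin 2) {x : ℝ} (hx : 0 < x) : 0 < fWord P ε n w x := by
  induction n with
  | zero => exact hx
  | succ n ih => exact f_pos hP hε_pos hε_lt _ (ih _)

theorem abs_log_fWord_sub_le (hP : ∀ i j, 0 < P i j) (hP_det : 0 < P.det) (hε_pos : 0 < ε)
    (hε_lt : ε < 1) {n : ℕ} (w : Fin n → Fin 2) {x y : ℝ} (hx : 0 < x) (hy : 0 < y) :
    |Real.log (fWord P ε n w x) - Real.log (fWord P ε n w y)| ≤
      contraction P ^ n * |Real.log x - Real.log y| := by
  induction n with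
  | zero => simp [fWord]
  | succ n ih =>
    refine (abs_log_f_sub_le hP hP_det hε_pos hε_lt _ (fWord_pos hP hε_pos hε_lt _ hx)
      (fWord_pos hP hε_pos hε_lt _ hy)).trans ?_
    rw [pow_succ', mul_assoc]
    exact mul_le_mul_of_nonneg_left (ih _) (contraction_nonneg hP hP_det)

/-! ### Orbits that start in the past -/

/-- The `n` letters of the bi-infinite sequence `z` that follow position `m`. -/
def window {S : Type*} (z : ℤ → S) (m : ℤ) (n : ℕ) (j : Fin n) : S := z (m + ((j : ℤ) + 1))

/-- Older letters act first, so extending a window into the past changes only the point fed to the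
recent maps. -/
theorem fWord_window_add (P : Matrix (Fin 2) (Fin 2) ℝ) (ε : ℝ) (z : ℤ → Fin 2) (m : ℤ)
    (n k : ℕ) : fWord P ε (n + k) (window z m (n + k)) =
      fWord P ε k (window z (m + n) k) ∘ fWord P ε n (window z m n) := by
  induction k with
  | zero => rfl
  | succ k ih =>
    change f P ε _ ∘ fWord P ε (n + k) (window z m (n + k)) =
      (f P ε _ ∘ fWord P ε k (window z (m + n) k)) ∘ _
    rw [ih, Function.comp_assoc]
    congr 2
    simp only [window, Fin.val_last, Nat.add_eq]
    congr 1
    push_cast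
    ring

/-- The orbit of `x₀` driven by the `n` letters of `z` up to position `0`. -/
noncomputable def backwardPoint (P : Matrix (Fin 2) (Fin 2) ℝ) (ε : ℝ) (z : ℤ → Fin 2)
    (n : ℕ) : ℝ :=
  fWord P ε n (window z (-n) n) (P 1 0 / P 0 1)

theorem backwardPoint_add (P : Matrix (Fin 2) (Fin 2) ℝ) (ε : ℝ) (z : ℤ → Fin 2) (n k : ℕ) :
    backwardPoint P ε z (k + n) = fWord P ε n (window z (-n) n)
      (fWord P ε k (window z (-(k + n : ℕ)) k) (P 1 0 / P 0 1)) := by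
  rw [backwardPoint, fWord_window_add, Function.comp_apply]
  congr 3
  push_cast
  ring

theorem NonOverlapping.exists_tendsto_backwardPoint (hno : NonOverlapping P ε)
    (hP : ∀ i j, 0 < P i j) (hP_sum : ∀ i, ∑ j, P i j = 1) (hP_det : 0 < P.det)
    (hε_pos : 0 < ε) (hε_lt : ε < 1) (z : ℤ → Fin 2) :
    ∃ x ∈ interval P ε, Tendsto (backwardPoint P ε z) atTop (𝓝 x) ∧
      ∀ n, x ∈ cylinder P ε n (window z (-n) n) := by
  have hstart := start_mem_interval hP hP_sum hP_det hε_pos hε_lt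
  have hpos : ∀ n, 0 < backwardPoint P ε z n := fun n =>
    fWord_pos hP hε_pos hε_lt _ (start_pos hP)
  -- `C` bounds the first displacement of `x₀`, uniformly over the two possible oldest letters.
  obtain ⟨C, hC⟩ : ∃ C, ∀ v : Fin 2,
      |Real.log (P 1 0 / P 0 1) - Real.log (f P ε v (P 1 0 / P 0 1))| ≤ C :=
    (Set.finite_range _).bddAbove.imp fun C hC v => hC ⟨v, rfl⟩
  have hstep : ∀ n, dist (Real.log (backwardPoint P ε z n))
      (Real.log (backwardPoint P ε z (n + 1))) ≤ C * contraction P ^ n := by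
    intro n
    rw [add_comm n 1, backwardPoint_add, Real.dist_eq, mul_comm]
    exact (abs_log_fWord_sub_le hP hP_det hε_pos hε_lt _ (start_pos hP)
      (fWord_pos hP hε_pos hε_lt _ (start_pos hP))).trans
        (mul_le_mul_of_nonneg_left (hC _) (pow_nonneg (contraction_nonneg hP hP_det) n))
  obtain ⟨L, hL⟩ := cauchySeq_tendsto_of_complete
    (cauchySeq_of_le_geometric _ _ (contraction_lt_one hP) hstep)
  have hlim : Tendsto (backwardPoint P ε z) atTop (𝓝 (Real.exp L)) := by
    refine ((Real.continuous_exp.tendsto L).comp hL).congr fun n => ?_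
    exact Real.exp_log (hpos n)
  have hcyl : ∀ n, Real.exp L ∈ cylinder P ε n (window z (-n) n) := by
    intro n
    refine (hno.isClosed_cylinder hP hε_pos hε_lt _).mem_of_tendsto
      (hlim.comp (tendsto_add_atTop_nat n)) (Eventually.of_forall fun k => ?_)
    rw [Function.comp_apply, backwardPoint_add]
    exact ⟨_, hno.fWord_mem_interval _ hstart, rfl⟩
  refine ⟨_, ?_, hlim, hcyl⟩
  -- The cylinder of the empty word is `I` itself.
  obtain ⟨y, hy, h⟩ := hcyl 0
  exact h ▸ hy

end Dynamics

/-! ### Stationarity of the observed process -/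

section Stationarity

variable {Ω : Type*} [MeasurableSpace Ω] {μ : Measure Ω}

theorem _root_.Int.eq_of_add_one_eq {α : Type*} {g : ℤ → α} (h : ∀ m, g (m + 1) = g m) (m : ℤ) :
    g m = g 0 := by
  induction m using Int.induction_on with
  | zero => rfl
  | succ k ih => rw [h, ih]
  | pred k ih => rw [← ih, ← h (-(k : ℤ) - 1), sub_add_cancel]

theorem IsStationaryMarkovChain.measureReal_word {S : Type*} [MeasurableSpace S]
    {P : Matrix S S ℝ} {Y : ℤ → Ω → S} (hY : IsStationaryMarkovChain P μ Y) (m : ℤ) (k : ℕ)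
    (s : ℕ → S) : μ.real {ω | ∀ j ≤ k, Y (m + (j : ℤ)) ω = s j} =
      μ.real {ω | ∀ j ≤ k, Y (0 + (j : ℤ)) ω = s j} := by
  induction k with
  | zero =>
    simpa using Int.eq_of_add_one_eq (g := fun m => μ.real {ω | Y m ω = s 0})
      (fun m => hY.stationary m (s 0)) m
  | succ k ih => rw [hY.markov, hY.markov, ih]

theorem measurable_window {S : Type*} [MeasurableSpace S] {X : ℤ → Ω → S}
    (hX : ∀ n, Measurable (X n)) (m : ℤ) (n : ℕ) :
    Measurable fun ω => window (fun i => X i ω) m n :=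
  measurable_pi_lambda _ fun _ => hX _

theorem IsStationaryMarkovChain.map_window [IsFiniteMeasure μ] {S : Type*} [MeasurableSpace S]
    [Countable S] [MeasurableSingletonClass S] {P : Matrix S S ℝ} {Y : ℤ → Ω → S}
    (hY : IsStationaryMarkovChain P μ Y) (m : ℤ) (n : ℕ) :
    μ.map (fun ω => window (fun i => Y i ω) m n) =
      μ.map (fun ω => window (fun i => Y i ω) 0 n) := by
  refine Measure.ext_of_singleton fun w => ?_
  rw [Measure.map_apply (measurable_window hY.measurable m n) (measurableSet_singleton w),
    Measure.map_apply (measurable_window hY.measurable 0 n) (measurableSet_singleton w)]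
  cases n with
  | zero =>
    congr 1
    ext ω
    exact iff_of_true (Subsingleton.elim _ _) (Subsingleton.elim _ _)
  | succ k =>
    -- `w` is extended periodically; only indices `j ≤ k` matter.
    let s : ℕ → S := fun j => w (Fin.ofNat (k + 1) j)
    have hset : ∀ m : ℤ, (fun ω => window (fun i => Y i ω) m (k + 1)) ⁻¹' {w} =
        {ω | ∀ j ≤ k, Y (m + 1 + (j : ℤ)) ω = s j} := by
      intro m
      ext ω
      simp only [Set.mem_preimage, Set.mem_singleton_iff, Set.mem_ofPred_eq, funext_iff, window]
      constructor
      · intro h j hj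
        rw [add_assoc, add_comm 1]
        have := h (Fin.ofNat (k + 1) j)
        rwa [Fin.val_ofNat, Nat.mod_eq_of_lt (Nat.lt_succ_of_le hj)] at this
      · intro h j
        have := h j (Nat.le_of_lt_succ j.2)
        rw [add_assoc, add_comm 1] at this
        rw [this]
        exact congrArg w (Fin.ofNat_val_eq_self j)
    rw [hset, hset, ← measureReal_eq_measureReal_iff, hY.measureReal_word,
      hY.measureReal_word (0 + 1)]

theorem IsBernoulliNoise.map_eq [IsProbabilityMeasure μ] {ε : ℝ} {E : ℤ → Ω → Fin 2}
    (hE : IsBernoulliNoise ε μ E) (m n : ℤ) : μ.map (E m) = μ.map (E n) := by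
  have := Measure.isProbabilityMeasure_map (μ := μ) (hE.measurable m).aemeasurable
  have := Measure.isProbabilityMeasure_map (μ := μ) (hE.measurable n).aemeasurable
  have hone : ∀ n, (μ.map (E n)).real {1} = ε := fun n => by
    rw [map_measureReal_apply (hE.measurable n) (measurableSet_singleton _)]
    exact hE.prob_error n
  have hcompl : ({1} : Set (Fin 2))ᶜ = {0} := by
    ext i
    fin_cases i <;> simp
  refine Measure.ext_of_singleton fun i => ?_
  rw [← measureReal_eq_measureReal_iff]
  fin_cases i
  · change (μ.map (E m)).real {0} = (μ.map (E n)).real {0}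
    rw [← hcompl, probReal_compl_eq_one_sub (measurableSet_singleton _),
      probReal_compl_eq_one_sub (measurableSet_singleton _), hone, hone]
  · exact (hone m).trans (hone n).symm

theorem IsBernoulliNoise.map_window [IsProbabilityMeasure μ] {ε : ℝ} {E : ℤ → Ω → Fin 2}
    (hE : IsBernoulliNoise ε μ E) (m : ℤ) (n : ℕ) :
    μ.map (fun ω => window (fun i => E i ω) m n) =
      μ.map (fun ω => window (fun i => E i ω) 0 n) := by
  have hpi : ∀ m : ℤ, μ.map (fun ω => window (fun i => E i ω) m n) =
      Measure.pi fun _ : Fin n => μ.map (E 0) := by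
    intro m
    have hinj : Function.Injective fun j : Fin n => m + ((j : ℤ) + 1) := fun i j h => by
      simpa [Fin.ext_iff] using h
    have h := (hE.indep.precomp hinj).map_fun_eq_pi_map fun _ => (hE.measurable _).aemeasurable
    refine h.trans ?_
    congr 1
    funext j
    exact hE.map_eq _ _
  rw [hpi, hpi]

variable {P : Matrix (Fin 2) (Fin 2) ℝ} {ε : ℝ} {Y E : ℤ → Ω → Fin 2}

theorem measurable_observed (hY : IsStationaryMarkovChain P μ Y) (hE : IsBernoulliNoise ε μ E)
    (n : ℤ) : Measurable (observed Y E n) :=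
  (measurable_of_finite fun p : Fin 2 × Fin 2 => p.1 + p.2).comp
    ((hY.measurable n).prodMk (hE.measurable n))

/-- The observed process is stationary. -/
theorem map_window_observed [IsProbabilityMeasure μ] (hY : IsStationaryMarkovChain P μ Y)
    (hE : IsBernoulliNoise ε μ E)
    (hYE : IndepFun (fun ω n => Y n ω) (fun ω n => E n ω) μ) (m : ℤ) (n : ℕ) :
    μ.map (fun ω => window (fun i => observed Y E i ω) m n) =
      μ.map (fun ω => window (fun i => observed Y E i ω) 0 n) := by
  have hwin : ∀ m : ℤ, Measurable fun z : ℤ → Fin 2 => window z m n :=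
    fun m => measurable_pi_lambda _ fun _ => measurable_pi_apply _
  have hadd : Measurable fun p : (Fin n → Fin 2) × (Fin n → Fin 2) => p.1 + p.2 :=
    measurable_of_finite _
  -- A window of `Z` is the sum of independent windows of `Y` and `E`, whose laws do not depend on
  -- `m`.
  have hlaw : ∀ m : ℤ, μ.map (fun ω => window (fun i => observed Y E i ω) m n) =
      ((μ.map fun ω => window (fun i => Y i ω) 0 n).prod
        (μ.map fun ω => window (fun i => E i ω) 0 n)).map fun p => p.1 + p.2 := by
    intro m
    have hYm := measurable_window hY.measurable m n
    have hEm := measurable_window hE.measurable m n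
    rw [← hY.map_window m, ← hE.map_window m,
      ← (indepFun_iff_map_prod_eq_prod_map_map hYm.aemeasurable hEm.aemeasurable).1
        (hYE.comp (hwin m) (hwin m)), Measure.map_map hadd (hYm.prodMk hEm)]
    rfl
  rw [hlaw m, hlaw 0]

theorem observedWord_eq_window {Ω : Type*} (Y E : ℤ → Ω → Fin 2) (n : ℕ) (ω : Ω) :
    observedWord Y E n ω = window (fun i => observed Y E i ω) 0 n := by
  funext j
  rw [window, zero_add]
  rfl

theorem measure_window_eq_wordProb [IsProbabilityMeasure μ] (hY : IsStationaryMarkovChain P μ Y)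
    (hE : IsBernoulliNoise ε μ E) (hYE : IndepFun (fun ω n => Y n ω) (fun ω n => E n ω) μ)
    (m : ℤ) (n : ℕ) (w : Fin n → Fin 2) :
    μ {ω | window (fun i => observed Y E i ω) m n = w} = wordProb μ Y E n w := by
  have hmeas := measurable_window (measurable_observed hY hE)
  have h := congrArg (fun ν => ν {w}) (map_window_observed hY hE hYE m n)
  simp only [Measure.map_apply (hmeas _ n) (measurableSet_singleton w)] at h
  simp only [wordProb, observedWord_eq_window]
  exact h

theorem measurable_backwardPoint (hY : IsStationaryMarkovChain P μ Y)
    (hE : IsBernoulliNoise ε μ E) (n : ℕ) :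
    Measurable fun ω => backwardPoint P ε (fun i => observed Y E i ω) n :=
  (measurable_of_finite fun w => fWord P ε n w (P 1 0 / P 0 1)).comp
    (measurable_window (measurable_observed hY hE) (-n) n)

theorem measurable_xPoint (hY : IsStationaryMarkovChain P μ Y) (hE : IsBernoulliNoise ε μ E)
    (n : ℕ) : Measurable (xPoint P ε Y E n) := by
  unfold xPoint
  simp only [observedWord_eq_window]
  exact (measurable_of_finite fun w => fWord P ε n w (P 1 0 / P 0 1)).comp
    (measurable_window (measurable_observed hY hE) 0 n)

theorem map_backwardPoint [IsProbabilityMeasure μ] (hY : IsStationaryMarkovChain P μ Y)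
    (hE : IsBernoulliNoise ε μ E)
    (hYE : IndepFun (fun ω n => Y n ω) (fun ω n => E n ω) μ) (n : ℕ) :
    μ.map (fun ω => backwardPoint P ε (fun i => observed Y E i ω) n) =
      μ.map (xPoint P ε Y E n) := by
  have hmeas := measurable_window (measurable_observed hY hE)
  have hw : Measurable fun w => fWord P ε n w (P 1 0 / P 0 1) := measurable_of_finite _
  have h := congrArg (Measure.map fun w => fWord P ε n w (P 1 0 / P 0 1))
    (map_window_observed hY hE hYE (-n) n)
  rw [Measure.map_map hw (hmeas _ n), Measure.map_map hw (hmeas _ n)] at h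
  refine h.trans ?_
  congr 1
  funext ω
  rw [xPoint, observedWord_eq_window]
  rfl

/-! ### Masses of cylinders and the limit law -/

theorem Qn_cylinder (hno : NonOverlapping P ε) (hP : ∀ i j, 0 < P i j)
    (hP_sum : ∀ i, ∑ j, P i j = 1) (hP_det : 0 < P.det) (hε_pos : 0 < ε) (hε_lt : ε < 1)
    (μ : Measure Ω) (Y E : ℤ → Ω → Fin 2) (n : ℕ) (w : Fin n → Fin 2) :
    Qn P ε μ Y E n (cylinder P ε n w) = wordProb μ Y E n w := by
  have hcyl := (hno.isClosed_cylinder hP hε_pos hε_lt w).measurableSet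
  have hstart := start_mem_interval hP hP_sum hP_det hε_pos hε_lt
  have hmem := fun v => hno.fWord_mem_cylinder hP hP_sum hP_det hε_pos hε_lt (v := v) (w := w)
    hstart
  have hind : ∀ v, (cylinder P ε n w).indicator (1 : ℝ → ENNReal)
      (fWord P ε n v (P 1 0 / P 0 1)) = if v = w then 1 else 0 := by
    classical
    intro v
    simp only [Set.indicator_apply, hmem, Pi.one_apply]
  simp [Qn, Measure.finsetSum_apply, Measure.dirac_apply' _ hcyl, hind]

end Stationarity

end BinaryHMM

theorem mainTheorem7 {Ω : Type*} [MeasurableSpace Ω] (μ : Measure Ω) [IsProbabilityMeasure μ]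
    (P : Matrix (Fin 2) (Fin 2) ℝ) (ε : ℝ) (Y E : ℤ → Ω → Fin 2)
    (hP_pos : ∀ i j, 0 < P i j) (hP_sum : ∀ i, ∑ j, P i j = 1) (hP_det : 0 < P.det)
    (hε_pos : 0 < ε) (hε_lt : ε < 1)
    (hY : BinaryHMM.IsStationaryMarkovChain P μ Y)
    (hE : BinaryHMM.IsBernoulliNoise ε μ E)
    (hYE : IndepFun (fun ω n => Y n ω) (fun ω n => E n ω) μ)
    (hno : BinaryHMM.NonOverlapping P ε) :
    ∃ Q : Measure ℝ, ∃ _ : IsProbabilityMeasure Q,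
      TendstoInDistribution (BinaryHMM.xPoint P ε Y E) atTop (id : ℝ → ℝ) (fun _ => μ) Q ∧
      ∀ (n : ℕ) (w : Fin n → Fin 2),
        Q (BinaryHMM.cylinder P ε n w) = BinaryHMM.wordProb μ Y E n w ∧
        BinaryHMM.Qn P ε μ Y E n (BinaryHMM.cylinder P ε n w) =
          BinaryHMM.wordProb μ Y E n w := by
  choose x hxI hlim hxcyl using fun ω => hno.exists_tendsto_backwardPoint hP_pos hP_sum hP_det
    hε_pos hε_lt fun i => BinaryHMM.observed Y E i ω
  have hback := BinaryHMM.measurable_backwardPoint hY hE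
  have hx : Measurable x := measurable_of_tendsto_metrizable hback (tendsto_pi_nhds.2 hlim)
  have hQ := Measure.isProbabilityMeasure_map (μ := μ) hx.aemeasurable
  refine ⟨μ.map x, hQ, ?_, fun n w => ⟨?_, ?_⟩⟩
  · have hdist := tendstoInDistribution_of_ae_tendsto (μ' := μ)
      (fun n => (hback n).aemeasurable) hx.aemeasurable (ae_of_all μ hlim)
    refine ⟨fun n => (BinaryHMM.measurable_xPoint hY hE n).aemeasurable, aemeasurable_id, ?_⟩
    rw [show (⟨(μ.map x).map id, Measure.isProbabilityMeasure_map aemeasurable_id⟩ :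
      ProbabilityMeasure ℝ) = ⟨μ.map x, hQ⟩ from Subtype.ext Measure.map_id]
    -- Convergence in distribution sees only laws, so it passes from the backward points to `xₙ`.
    exact hdist.tendsto.congr fun n => Subtype.ext (BinaryHMM.map_backwardPoint hY hE hYE n)
  · rw [Measure.map_apply hx (hno.isClosed_cylinder hP_pos hε_pos hε_lt w).measurableSet,
      ← BinaryHMM.measure_window_eq_wordProb hY hE hYE (-n) n w]
    congr 1
    ext ω
    -- The limit is the image of some `y ∈ I` under the last `n` letters, so disjointness of
    -- cylinders reads those letters off.
    obtain ⟨y, hy, hyx⟩ := hxcyl ω n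
    rw [Set.mem_preimage, ← hyx]
    exact hno.fWord_mem_cylinder hP_pos hP_sum hP_det hε_pos hε_lt hy
  · exact BinaryHMM.Qn_cylinder hno hP_pos hP_sum hP_det hε_pos hε_lt μ Y E n w
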